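/- Let $K\subset\mathbb R^3$ be a strictly convex body, i.e. a compact strictly convex set with non-empty interior. A chord of a convex body is a non-degenerate segment that is the intersection of the body with a line, and a point in the interior of a convex body is called an equichordal point of it if all its chords through that point have the same length. For a unit vector $u\in\mathbb S^2$ let $\pi_u$ denote the orthogonal projection of $\mathbb R^3$ onto the plane $u^\perp$. An affine diameter of $K$ is a chord $[a,b]$ of $K$ such that there are two distinct parallel support planes of $K$, one through $a$ and one through $b$. Let $p$ be an equichordal point of $K$, and suppose that for every $u\in\mathbb S^2$ the point $\pi_u(p)$ is an equichordal point of $\pi_u(K)$ (as a convex body in the plane $u^\perp$). Then $K$ is a body of revolution. More precisely, there is an affine diameter of $K$ passing through $p$, and for every affine diameter $[a,b]$ of $K$ passing through $p$ the line $ab$ is an axis of revolution of $K$, i.e. $K$ is invariant under all rotations about the line $ab$. -/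

import Mathlib

/-- Euclidean three-space. -/
abbrev E3 : Type := EuclideanSpace ℝ (Fin 3)

namespace BodyGeom

/-- `[a, b]` is a (nondegenerate) chord of `K`: the intersection of `K` with a line. -/
def IsChord {E : Type*} [NormedAddCommGroup E] [NormedSpace ℝ E]
    (K : Set E) (a b : E) : Prop :=
  a ≠ b ∧ (affineSpan ℝ {a, b} : Set E) ∩ K = segment ℝ a b

/-- `x` is an equichordal point of `K`: it lies in the interior of `K`, and all chords of `K`
through `x` have the same length. -/
def IsEquichordalPoint {E : Type*} [NormedAddCommGroup E] [NormedSpace ℝ E]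
    (K : Set E) (x : E) : Prop :=
  x ∈ interior K ∧ ∃ c : ℝ, ∀ a b : E, IsChord K a b → x ∈ segment ℝ a b → dist a b = c

/-- `[a, b]` is an affine diameter of `K`: a chord of `K` such that there are two distinct parallel
support planes of `K` (here with common normal vector `v`), one through `a` and one through `b`. -/
def IsAffineDiameter (K : Set E3) (a b : E3) : Prop :=
  IsChord K a b ∧ ∃ v : E3, inner ℝ v b < inner ℝ v a ∧
    ∀ x ∈ K, inner ℝ v b ≤ inner ℝ v x ∧ inner ℝ v x ≤ inner ℝ v a

/-- The orthogonal projection `π_u` of three-space onto the plane `u^⊥` through the origin. The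
plane is used as a space of its own, so interiors of its subsets are relative to the plane. -/
noncomputable def proj (u : E3) : E3 →L[ℝ] (Submodule.span ℝ {u})ᗮ :=
  (Submodule.span ℝ {u})ᗮ.orthogonalProjectionOnto

/-- `f` is a rotation about the line `l`: an orientation preserving isometry of three-space that
fixes every point of `l`. -/
def IsRotationAbout (l : AffineSubspace ℝ E3) (f : E3 ≃ᵃⁱ[ℝ] E3) : Prop :=
  (∀ x ∈ l, f x = x) ∧
    LinearMap.det (f.linearIsometryEquiv.toLinearEquiv : E3 →ₗ[ℝ] E3) = 1

/-- `K` is a body of revolution with axis `l`: it is invariant under every rotation about `l`. -/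
def IsBodyOfRevolution (K : Set E3) (l : AffineSubspace ℝ E3) : Prop :=
  ∀ f : E3 ≃ᵃⁱ[ℝ] E3, IsRotationAbout l f → f '' K = K

end BodyGeom

/-! Let `c` be the chord length of K at p, and `c'` that of the projection along u at the image of
p. The projection contains a copy of the section of K by the plane through p normal to u, so `c ≤
c'`. If an affine diameter [a,b] through p has support planes with normal v and u ⟂ v, then [a,b]
projects to a chord, so `c' ≤ ‖a - b‖ = c`. Equality makes u ⟂ a - b, hence a - b is parallel to v,
and it makes projection and section coincide: K is mapped into itself by projection onto every plane
containing the line ab (`IsAffineDiameter.sub_inner_smul_mem`). Composing n such projections, turned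
by θ/n each, rotates a point of such a plane by θ and scales its distance to the axis by cos(θ/n)^n
→ 1. As K is closed, it contains the rotated point (`mem_of_orthonormalBasis`). An affine diameter
through p is the chord through a point of K farthest from p (`exists_isAffineDiameter`). -/

namespace BodyGeom

/-! ### Chords through an interior point, parametrized by arc length. -/

section Chord

variable {E : Type*} [NormedAddCommGroup E] [NormedSpace ℝ E] {K : Set E} {x w : E}

theorem isChord_of_forall_mem_iff {s t : ℝ} (hs : 0 < s) (ht : 0 < t) (hw : ‖w‖ = 1)
    (h : ∀ r : ℝ, x + r • w ∈ K ↔ -t ≤ r ∧ r ≤ s) :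
    IsChord K (x + s • w) (x + (-t) • w) ∧
      x ∈ segment ℝ (x + s • w) (x + (-t) • w) ∧
      dist (x + s • w) (x + (-t) • w) = s + t := by
  have hlm : ∀ r : ℝ, AffineMap.lineMap (x + s • w) (x + (-t) • w) r =
      x + (s - r * (s + t)) • w := by
    intro r
    simp only [AffineMap.lineMap_apply, vsub_eq_sub, vadd_eq_add]
    module
  have hd : dist (x + s • w) (x + (-t) • w) = s + t := by
    rw [dist_eq_norm, show x + s • w - (x + (-t) • w) = (s + t) • w by module, norm_smul, hw,
      Real.norm_of_nonneg (by positivity), mul_one]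
  have hst : 0 < s + t := by positivity
  refine ⟨⟨?_, ?_⟩, ?_, hd⟩
  · rw [← dist_pos, hd]
    exact hst
  · ext y
    simp only [Set.mem_inter_iff, SetLike.mem_coe, mem_affineSpan_pair_iff_exists_lineMap_eq,
      segment_eq_image_lineMap, Set.mem_image, Set.mem_Icc]
    constructor
    · rintro ⟨⟨r, rfl⟩, hy⟩
      rw [hlm, h] at hy
      refine ⟨r, ⟨?_, ?_⟩, rfl⟩
      · by_contra! hr
        nlinarith [mul_neg_of_neg_of_pos hr hst]
      · by_contra! hr
        nlinarith [mul_pos (sub_pos.2 hr) hst]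
    · rintro ⟨r, ⟨h0, h1⟩, rfl⟩
      refine ⟨⟨r, rfl⟩, ?_⟩
      rw [hlm, h]
      constructor <;> nlinarith
  · rw [segment_eq_image_lineMap]
    refine ⟨s / (s + t), ⟨by positivity, (div_le_one hst).2 (by linarith)⟩, ?_⟩
    rw [hlm, div_mul_cancel₀ _ hst.ne']
    simp

theorem exists_forall_add_smul_mem_iff (hK : IsCompact K) (hconv : Convex ℝ K)
    (hx : x ∈ interior K) (hw : ‖w‖ = 1) :
    ∃ s t : ℝ, 0 < s ∧ 0 < t ∧ ∀ r : ℝ, x + r • w ∈ K ↔ -t ≤ r ∧ r ≤ s := by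
  have hiso : Isometry fun r : ℝ => x + r • w := by
    refine Isometry.of_dist_eq fun r r' => ?_
    rw [dist_add_left, dist_eq_norm, ← sub_smul, norm_smul, hw, mul_one, dist_eq_norm]
  set S : Set ℝ := (fun r : ℝ => x + r • w) ⁻¹' K with hS
  have hcomp : IsCompact S := hiso.isClosedEmbedding.isCompact_preimage hK
  have hnhds : S ∈ nhds (0 : ℝ) := by
    refine hiso.continuous.continuousAt.preimage_mem_nhds ?_
    simpa using mem_interior_iff_mem_nhds.1 hx
  have hcS : Convex ℝ S := by
    intro r hr r' hr' a b ha hb hab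
    have := hconv hr hr' ha hb hab
    simp only [hS, Set.mem_preimage]
    convert this using 1
    obtain rfl : b = 1 - a := by linarith
    simp only [smul_eq_mul]
    module
  have hIcc := eq_Icc_of_connected_compact
    ⟨⟨0, mem_of_mem_nhds hnhds⟩, hcS.isPreconnected⟩ hcomp
  rw [hIcc, Icc_mem_nhds_iff] at hnhds
  refine ⟨sSup S, -sInf S, hnhds.2, neg_pos.2 hnhds.1, fun r => ?_⟩
  rw [neg_neg]
  exact Set.ext_iff.1 hIcc r

theorem exists_chord_through {c : ℝ} (hK : IsCompact K) (hconv : Convex ℝ K)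
    (hx : x ∈ interior K)
    (hc : ∀ a b : E, IsChord K a b → x ∈ segment ℝ a b → dist a b = c) (hw : ‖w‖ = 1) :
    ∃ s t : ℝ, 0 < s ∧ 0 < t ∧ s + t = c ∧ (∀ r : ℝ, x + r • w ∈ K ↔ -t ≤ r ∧ r ≤ s) := by
  obtain ⟨s, t, hs, ht, h⟩ := exists_forall_add_smul_mem_iff hK hconv hx hw
  obtain ⟨h1, h2, h3⟩ := isChord_of_forall_mem_iff hs ht hw h
  exact ⟨s, t, hs, ht, h3 ▸ hc _ _ h1 h2, h⟩

end Chord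

/-! ### Auxiliary limit, polar coordinates, formula for the projection. -/

/-- Bernoulli's inequality and cos t ≥ 1 - t²/2 give the lower bound 1 - θ²/(2n). -/
theorem tendsto_cos_div_pow (θ : ℝ) :
    Filter.Tendsto (fun n : ℕ => Real.cos (θ / n) ^ n) Filter.atTop (nhds 1) := by
  have h0 : Filter.Tendsto (fun n : ℕ => 1 - θ ^ 2 / 2 / (n : ℝ)) Filter.atTop (nhds 1) := by
    convert (tendsto_const_div_atTop_nhds_zero_nat (θ ^ 2 / 2)).const_sub (1 : ℝ) using 2
    exact (sub_zero 1).symm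
  refine tendsto_of_tendsto_of_tendsto_of_le_of_le' h0 tendsto_const_nhds ?_ ?_
  · filter_upwards [Filter.eventually_ge_atTop 1, h0.eventually (lt_mem_nhds zero_lt_one)]
      with n hn hpos
    have hn' : (1 : ℝ) ≤ n := by exact_mod_cast hn
    have hq : (θ / n) ^ 2 / 2 = θ ^ 2 / 2 / n / n := by field_simp
    have hle : θ ^ 2 / 2 / n / n ≤ θ ^ 2 / 2 / (n : ℝ) := div_le_self (by positivity) hn'
    have hc := Real.one_sub_sq_div_two_le_cos (x := θ / n)
    rw [hq] at hc
    calc 1 - θ ^ 2 / 2 / (n : ℝ) = 1 + n * (-(θ ^ 2 / 2 / n / n)) := by field_simp; ring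
      _ ≤ (1 + -(θ ^ 2 / 2 / n / n)) ^ n := one_add_mul_le_pow (by linarith) n
      _ ≤ Real.cos (θ / n) ^ n := pow_le_pow_left₀ (by linarith) (by linarith) n
  · refine Filter.Eventually.of_forall fun n => ?_
    calc Real.cos (θ / n) ^ n ≤ |Real.cos (θ / n) ^ n| := le_abs_self _
      _ = |Real.cos (θ / n)| ^ n := abs_pow _ _
      _ ≤ 1 := pow_le_one₀ (abs_nonneg _) (Real.abs_cos_le_one _)

theorem exists_polar (x y : ℝ) :
    ∃ α : ℝ, x = √(x ^ 2 + y ^ 2) * Real.cos α ∧ y = √(x ^ 2 + y ^ 2) * Real.sin α := by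
  have hn : ‖(⟨x, y⟩ : ℂ)‖ = √(x ^ 2 + y ^ 2) := by
    rw [Complex.norm_eq_sqrt_sq_add_sq]
  exact ⟨Complex.arg ⟨x, y⟩, by rw [← hn, Complex.norm_mul_cos_arg],
    by rw [← hn, Complex.norm_mul_sin_arg]⟩

theorem proj_self (u : E3) (w : (Submodule.span ℝ {u})ᗮ) : proj u w = w :=
  Submodule.orthogonalProjectionOnto_mem_subspace_eq_self w

theorem coe_proj {u : E3} (hu : ‖u‖ = 1) (x : E3) :
    (proj u x : E3) = x - inner ℝ u x • u := by
  have hmem : x - inner ℝ u x • u ∈ (Submodule.span ℝ {u})ᗮ := by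
    rw [Submodule.mem_orthogonal_singleton_iff_inner_right, inner_sub_right, inner_smul_right,
      real_inner_self_eq_norm_sq, hu]
    ring
  have h0 : proj u u = 0 :=
    Submodule.orthogonalProjectionOnto_orthogonal_apply_eq_zero (Submodule.mem_span_singleton_self u)
  have h1 : proj u (x - inner ℝ u x • u) = ⟨_, hmem⟩ := proj_self u ⟨_, hmem⟩
  rw [map_sub, map_smul, h0, smul_zero, sub_zero] at h1
  rw [h1]

/-! ### Comparison of sections with projections. -/

section Sections

variable {K : Set E3} {p u : E3} {c c' : ℝ}

theorem exists_chord_through_proj (hK : IsCompact K) (hconv : Convex ℝ K) (hp : p ∈ interior K)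
    (hc : ∀ a b : E3, IsChord K a b → p ∈ segment ℝ a b → dist a b = c)
    (hp' : proj u p ∈ interior (proj u '' K))
    (hc' : ∀ a b, IsChord (proj u '' K) a b → proj u p ∈ segment ℝ a b → dist a b = c')
    (w : (Submodule.span ℝ {u})ᗮ) (hw : ‖w‖ = 1) :
    ∃ s t s' t' : ℝ, s + t = c ∧ s' + t' = c' ∧ s ≤ s' ∧ t ≤ t' ∧ 0 < t ∧
      (∀ r : ℝ, p + r • (w : E3) ∈ K ↔ -t ≤ r ∧ r ≤ s) ∧
      (∀ r : ℝ, proj u p + r • w ∈ proj u '' K ↔ -t' ≤ r ∧ r ≤ s') := by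
  obtain ⟨s, t, hs, ht, hst, h⟩ := exists_chord_through hK hconv hp hc (w := (w : E3)) hw
  obtain ⟨s', t', hs', ht', hst', h'⟩ := exists_chord_through
    (hK.image (proj u).continuous) (hconv.linear_image (proj u).toLinearMap) hp' hc' hw
  have key : ∀ r : ℝ, p + r • (w : E3) ∈ K → proj u p + r • w ∈ proj u '' K := by
    intro r hr
    refine ⟨_, hr, ?_⟩
    rw [map_add, map_smul, proj_self]
  refine ⟨s, t, s', t', hst, hst', ?_, ?_, ht, h, h'⟩
  · exact ((h' s).1 (key s ((h s).2 ⟨by linarith, le_rfl⟩))).2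
  · have := ((h' (-t)).1 (key (-t) ((h (-t)).2 ⟨le_rfl, by linarith⟩))).1
    linarith

/-- In each direction the two arms of the section's chord are at most those of the projection's
chord; `c' ≤ c` forces equality, so the projection is no larger than the section. -/
theorem sub_inner_smul_mem (hK : IsCompact K) (hconv : Convex ℝ K) (hp : p ∈ interior K)
    (hc : ∀ a b : E3, IsChord K a b → p ∈ segment ℝ a b → dist a b = c)
    (hu : ‖u‖ = 1) (hp' : proj u p ∈ interior (proj u '' K))
    (hc' : ∀ a b, IsChord (proj u '' K) a b → proj u p ∈ segment ℝ a b → dist a b = c')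
    (hcc : c' ≤ c) {x : E3} (hx : x ∈ K) :
    x - inner ℝ u (x - p) • u ∈ K := by
  have hy : x - inner ℝ u (x - p) • u = p + (proj u (x - p) : E3) := by
    rw [coe_proj hu]
    abel
  rw [hy]
  by_cases h0 : proj u (x - p) = 0
  · rw [h0]
    simpa using interior_subset hp
  have hn : ‖proj u (x - p)‖ ≠ 0 := norm_ne_zero_iff.2 h0
  have hrw : ‖proj u (x - p)‖ • (‖proj u (x - p)‖⁻¹ • proj u (x - p)) = proj u (x - p) := by
    rw [smul_smul, mul_inv_cancel₀ hn, one_smul]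
  obtain ⟨s, t, s', t', hst, hst', hss, htt, ht, h, h'⟩ := exists_chord_through_proj hK hconv hp hc hp'
    hc' (‖proj u (x - p)‖⁻¹ • proj u (x - p)) (norm_smul_inv_norm h0)
  have h1 := (h' ‖proj u (x - p)‖).1 (by
    rw [hrw, map_sub, add_sub_cancel]
    exact Set.mem_image_of_mem _ hx)
  have h2 := (h ‖proj u (x - p)‖).2 ⟨by linarith [norm_nonneg (proj u (x - p))], by linarith⟩
  rwa [← Submodule.coe_smul, hrw] at h2

/-- Here `v` only supplies a direction in which to compare chords. -/
theorem le_of_isChord_proj (hK : IsCompact K) (hconv : Convex ℝ K) (hp : p ∈ interior K)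
    (hc : ∀ a b : E3, IsChord K a b → p ∈ segment ℝ a b → dist a b = c)
    (hp' : proj u p ∈ interior (proj u '' K))
    (hc' : ∀ a b, IsChord (proj u '' K) a b → proj u p ∈ segment ℝ a b → dist a b = c')
    {v : E3} (hv : v ≠ 0) (huv : inner ℝ u v = 0) : c ≤ c' := by
  have hmem : v ∈ (Submodule.span ℝ {u})ᗮ :=
    Submodule.mem_orthogonal_singleton_iff_inner_right.2 huv
  have hv' : (⟨v, hmem⟩ : (Submodule.span ℝ {u})ᗮ) ≠ 0 := by
    intro h
    exact hv (congrArg Subtype.val h)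
  obtain ⟨s, t, s', t', hst, hst', hss, htt, -, -, -⟩ := exists_chord_through_proj hK hconv hp hc hp'
    hc' _ (norm_smul_inv_norm (𝕜 := ℝ) hv')
  linarith

/-- Since `v` lies in the plane of projection, the two support planes project to support lines,
which confine the line through the images to the segment. -/
theorem isChord_proj {a b v : E3} (hconv : Convex ℝ K) (ha : a ∈ K) (hb : b ∈ K)
    (huv : inner ℝ u v = 0) (hab : inner ℝ v b < inner ℝ v a)
    (hv : ∀ x ∈ K, inner ℝ v b ≤ inner ℝ v x ∧ inner ℝ v x ≤ inner ℝ v a) :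
    IsChord (proj u '' K) (proj u a) (proj u b) := by
  have hmem : v ∈ (Submodule.span ℝ {u})ᗮ :=
    Submodule.mem_orthogonal_singleton_iff_inner_right.2 huv
  have hin : ∀ x : E3, inner ℝ (⟨v, hmem⟩ : (Submodule.span ℝ {u})ᗮ) (proj u x) = inner ℝ v x :=
    fun x => Submodule.inner_orthogonalProjectionOnto_eq_of_mem_left _ _
  refine ⟨fun h => ?_, Set.Subset.antisymm ?_ (Set.subset_inter ?_ ?_)⟩
  · rw [← hin a, ← hin b, h] at hab
    exact hab.false
  · rintro _ ⟨hy, x, hx, rfl⟩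
    obtain ⟨r, hr⟩ := mem_affineSpan_pair_iff_exists_lineMap_eq.1 hy
    rw [segment_eq_image_lineMap]
    refine ⟨r, ?_, hr⟩
    have h := congrArg (inner ℝ (⟨v, hmem⟩ : (Submodule.span ℝ {u})ᗮ)) hr
    rw [AffineMap.lineMap_apply_module', inner_add_right, inner_smul_right, inner_sub_right, hin,
      hin, hin] at h
    obtain ⟨h1, h2⟩ := hv x hx
    constructor
    · by_contra! hneg
      nlinarith
    · by_contra! hneg
      nlinarith
  · rw [segment_eq_image_lineMap]
    rintro _ ⟨r, -, rfl⟩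
    exact AffineMap.lineMap_mem_affineSpan_pair _ _ _
  · exact (hconv.linear_image (proj u).toLinearMap).segment_subset (Set.mem_image_of_mem _ ha)
      (Set.mem_image_of_mem _ hb)

theorem IsAffineDiameter.mem {a b : E3} (h : IsAffineDiameter K a b) : a ∈ K ∧ b ∈ K := by
  have hs : segment ℝ a b ⊆ K := h.1.2 ▸ Set.inter_subset_right
  exact ⟨hs (left_mem_segment ℝ a b), hs (right_mem_segment ℝ a b)⟩

/-- Orthogonal projections along directions normal to an affine diameter through an equichordal
point, all of whose projections are equichordal, map the body into itself. -/
theorem IsAffineDiameter.sub_inner_smul_mem {a b : E3} (hK : IsCompact K) (hconv : Convex ℝ K)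
    (hp : IsEquichordalPoint K p)
    (hproj : ∀ u ∈ Metric.sphere (0 : E3) 1, IsEquichordalPoint (proj u '' K) (proj u p))
    (hab : IsAffineDiameter K a b) (hpab : p ∈ segment ℝ a b)
    (hu : ‖u‖ = 1) (hue : inner ℝ u (a - b) = 0) {x : E3} (hx : x ∈ K) :
    x - inner ℝ u (x - p) • u ∈ K := by
  obtain ⟨hpi, c, hc⟩ := hp
  obtain ⟨ha, hb⟩ := hab.mem
  obtain ⟨hch, v, hvab, hv⟩ := hab
  have hdc : dist a b = c := hc a b hch hpab
  have hv0 : v ≠ 0 := by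
    rintro rfl
    simp at hvab
  have key : ∀ u : E3, ‖u‖ = 1 → inner ℝ u v = 0 → inner ℝ u (a - b) = 0 ∧
      ∀ x ∈ K, x - inner ℝ u (x - p) • u ∈ K := by
    intro u hu huv
    obtain ⟨hpi', c', hc'⟩ := hproj u (by simpa using hu)
    have hle := le_of_isChord_proj hK hconv hpi hc hpi' hc' hv0 huv
    have hd' := hc' _ _ (isChord_proj hconv ha hb huv hvab hv) (by
      have := Set.mem_image_of_mem (proj u).toLinearMap.toAffineMap hpab
      rw [image_segment] at this
      exact this)
    have hsq : ‖proj u (a - b)‖ ^ 2 = ‖a - b‖ ^ 2 - inner ℝ u (a - b) ^ 2 := by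
      rw [Submodule.norm_coe (proj u (a - b)) |>.symm, coe_proj hu, norm_sub_sq_real, norm_smul, hu,
        inner_smul_right, real_inner_comm, Real.norm_eq_abs, mul_one, sq_abs]
      ring
    rw [dist_eq_norm, ← map_sub] at hd'
    rw [dist_eq_norm] at hdc
    rw [hd', hdc] at hsq
    have hc0 : 0 ≤ c := hdc ▸ norm_nonneg _
    have hz : inner ℝ u (a - b) ^ 2 = 0 := by nlinarith [sq_nonneg (inner ℝ u (a - b))]
    refine ⟨pow_eq_zero_iff two_ne_zero |>.1 hz, fun x hx => ?_⟩
    refine BodyGeom.sub_inner_smul_mem hK hconv hpi hc hu hpi' hc' ?_ hx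
    rw [hz] at hsq
    have : 0 ≤ c' := hd' ▸ norm_nonneg _
    nlinarith
  refine (key u hu ?_).2 x hx
  have hvn : 0 < ‖v‖ ^ 2 := by positivity
  set k : ℝ := inner ℝ v (a - b) / ‖v‖ ^ 2 with hk
  have hk0 : 0 < k := by
    rw [hk, inner_sub_right]
    exact div_pos (sub_pos.2 hvab) hvn
  set z : E3 := a - b - k • v with hz
  have hzv : inner ℝ z v = 0 := by
    rw [hz, inner_sub_left, inner_smul_left, real_inner_self_eq_norm_sq, real_inner_comm, hk]
    simp [div_mul_cancel₀ _ hvn.ne']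
  -- `z` is the part of `a - b` orthogonal to `v`; by `key` its direction is also orthogonal to `a -
  -- b`. Hence `a - b = k • v`, and `hue` becomes orthogonality to `v`.
  have hz0 : z = 0 := by
    by_contra hne
    have hn : ‖z‖ ≠ 0 := norm_ne_zero_iff.2 hne
    have h1 := (key (‖z‖⁻¹ • z) (norm_smul_inv_norm (𝕜 := ℝ) hne) (by
      rw [inner_smul_left, hzv, mul_zero])).1
    rw [inner_smul_left] at h1
    have h2 : inner ℝ z (a - b) = 0 := by simpa [hn] using h1
    rw [show a - b = z + k • v by rw [hz]; abel, inner_add_right, inner_smul_right, hzv, mul_zero,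
      add_zero] at h2
    exact hne (inner_self_eq_zero.1 h2)
  rw [hz, sub_eq_zero] at hz0
  rw [hz0, inner_smul_right] at hue
  exact (mul_eq_zero.1 hue).resolve_left hk0.ne'

end Sections

/-! ### Rotations as limits of iterated projections. -/

section Revolution

theorem mem_of_orthonormalBasis {K : Set E3} {p : E3} (hK : IsClosed K)
    (B : OrthonormalBasis (Fin 3) ℝ E3)
    (H : ∀ u : E3, ‖u‖ = 1 → inner ℝ u (B 0) = 0 → ∀ x ∈ K, x - inner ℝ u (x - p) • u ∈ K)
    {h ρ α β : ℝ}
    (hx : p + (h • B 0 + (ρ * Real.cos α) • B 1 + (ρ * Real.sin α) • B 2) ∈ K) :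
    p + (h • B 0 + (ρ * Real.cos β) • B 1 + (ρ * Real.sin β) • B 2) ∈ K := by
  have hB : ∀ i j, inner ℝ (B i) (B j) = if i = j then (1 : ℝ) else 0 :=
    orthonormal_iff_ite.1 B.orthonormal
  -- Project onto the plane through the axis at angle `α + δ`: the radius is multiplied by `cos δ`.
  have step : ∀ ρ α δ : ℝ, p + (h • B 0 + (ρ * Real.cos α) • B 1 + (ρ * Real.sin α) • B 2) ∈ K →
      p + (h • B 0 + (ρ * Real.cos δ * Real.cos (α + δ)) • B 1 +
        (ρ * Real.cos δ * Real.sin (α + δ)) • B 2) ∈ K := by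
    intro ρ α δ hmem
    have h1 : ‖(-Real.sin (α + δ)) • B 1 + Real.cos (α + δ) • B 2‖ = 1 := by
      have : ‖(-Real.sin (α + δ)) • B 1 + Real.cos (α + δ) • B 2‖ ^ 2 = 1 := by
        rw [← real_inner_self_eq_norm_sq]
        simp only [inner_add_left, inner_add_right, real_inner_smul_left, real_inner_smul_right, hB]
        simp
        linarith [Real.sin_sq_add_cos_sq (α + δ)]
      exact (pow_eq_one_iff_of_nonneg (norm_nonneg _) two_ne_zero).1 this
    have h2 := H _ h1 (by simp [inner_add_left, inner_smul_left, hB]) _ hmem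
    have h3 : inner ℝ ((-Real.sin (α + δ)) • B 1 + Real.cos (α + δ) • B 2)
        (h • B 0 + (ρ * Real.cos α) • B 1 + (ρ * Real.sin α) • B 2) = -(ρ * Real.sin δ) := by
      simp [inner_add_left, inner_add_right, inner_smul_left, inner_smul_right, hB]
      rw [Real.sin_add, Real.cos_add]
      linear_combination (-ρ * Real.sin δ) * Real.sin_sq_add_cos_sq α
    rw [add_sub_cancel_left, h3] at h2
    convert h2 using 1
    have e1 : ρ * Real.cos δ * Real.cos (α + δ) =
        ρ * Real.cos α - ρ * Real.sin δ * Real.sin (α + δ) := by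
      rw [Real.sin_add, Real.cos_add]
      linear_combination (ρ * Real.cos α) * Real.sin_sq_add_cos_sq δ
    have e2 : ρ * Real.cos δ * Real.sin (α + δ) =
        ρ * Real.sin α + ρ * Real.sin δ * Real.cos (α + δ) := by
      rw [Real.sin_add, Real.cos_add]
      linear_combination (ρ * Real.sin α) * Real.sin_sq_add_cos_sq δ
    rw [e1, e2]
    module
  have iter : ∀ (δ : ℝ) (k : ℕ), p + (h • B 0 +
      (ρ * Real.cos δ ^ k * Real.cos (α + k * δ)) • B 1 +
      (ρ * Real.cos δ ^ k * Real.sin (α + k * δ)) • B 2) ∈ K := by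
    intro δ k
    induction k with
    | zero => simpa using hx
    | succ k ih =>
      have := step _ _ δ ih
      rw [mul_assoc ρ, ← pow_succ, show α + k * δ + δ = α + (k + 1 : ℕ) * δ by
        push_cast; ring] at this
      exact this
  have hlim := tendsto_cos_div_pow (β - α)
  have hcont : Continuous fun t : ℝ => p + (h • B 0 + (ρ * t * Real.cos β) • B 1 +
      (ρ * t * Real.sin β) • B 2) := by fun_prop
  have ht := (hcont.tendsto 1).comp hlim
  simp only [mul_one] at ht
  refine hK.mem_of_tendsto ht ?_
  filter_upwards [Filter.eventually_ge_atTop 1] with n hn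
  have hn0 : (n : ℝ) ≠ 0 := by positivity
  have := iter ((β - α) / n) n
  rwa [mul_div_cancel₀ _ hn0, add_sub_cancel] at this

theorem mem_of_inner_eq_of_norm_eq {K : Set E3} {p e x z : E3} (hK : IsClosed K) (he : ‖e‖ = 1)
    (H : ∀ u : E3, ‖u‖ = 1 → inner ℝ u e = 0 → ∀ x ∈ K, x - inner ℝ u (x - p) • u ∈ K)
    (hx : x ∈ K) (hin : inner ℝ e (z - p) = inner ℝ e (x - p)) (hn : ‖z - p‖ = ‖x - p‖) :
    z ∈ K := by
  obtain ⟨B, hB⟩ := Orthonormal.exists_orthonormalBasis_extension_of_card_eq (𝕜 := ℝ) (E := E3)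
    (ι := Fin 3) (by simp) (v := fun _ => e) (s := {0}) (by
      rw [orthonormal_iff_ite]
      rintro ⟨i, rfl⟩ ⟨j, rfl⟩
      simp [he])
  have hB0 : B 0 = e := hB 0 (Set.mem_singleton 0)
  have hexp : ∀ y : E3, y = p + (inner ℝ e (y - p) • B 0 + inner ℝ (B 1) (y - p) • B 1 +
      inner ℝ (B 2) (y - p) • B 2) := by
    intro y
    have := B.sum_repr' (y - p)
    rw [Fin.sum_univ_three] at this
    rw [← hB0, this]
    abel
  have hsq : ∀ y : E3, ‖y - p‖ ^ 2 = inner ℝ e (y - p) ^ 2 + (inner ℝ (B 1) (y - p) ^ 2 +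
      inner ℝ (B 2) (y - p) ^ 2) := by
    intro y
    have := B.sum_sq_norm_inner_right (y - p)
    rw [Fin.sum_univ_three] at this
    simp only [Real.norm_eq_abs, sq_abs] at this
    rw [← this, hB0, add_assoc]
  obtain ⟨α, h1, h2⟩ := exists_polar (inner ℝ (B 1) (x - p)) (inner ℝ (B 2) (x - p))
  obtain ⟨β, h3, h4⟩ := exists_polar (inner ℝ (B 1) (z - p)) (inner ℝ (B 2) (z - p))
  have hρ : inner ℝ (B 1) (z - p) ^ 2 + inner ℝ (B 2) (z - p) ^ 2 =
      inner ℝ (B 1) (x - p) ^ 2 + inner ℝ (B 2) (x - p) ^ 2 := by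
    have h5 := hsq z
    rw [hn, hsq x, hin] at h5
    linarith
  have hx' : p + (inner ℝ e (x - p) • B 0 + (√(inner ℝ (B 1) (x - p) ^ 2 +
      inner ℝ (B 2) (x - p) ^ 2) * Real.cos α) • B 1 + (√(inner ℝ (B 1) (x - p) ^ 2 +
      inner ℝ (B 2) (x - p) ^ 2) * Real.sin α) • B 2) ∈ K := by
    rw [← h1, ← h2, ← hexp x]
    exact hx
  have hz := mem_of_orthonormalBasis hK B (by rwa [hB0]) (β := β) hx'
  rwa [← hρ, ← h3, ← h4, ← hin, ← hexp z] at hz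

end Revolution

/-! ### An affine diameter through the equichordal point. -/

section Existence

theorem exists_isAffineDiameter {K : Set E3} {p : E3} (hK : IsCompact K) (hconv : Convex ℝ K)
    (hp : IsEquichordalPoint K p) :
    ∃ a b : E3, IsAffineDiameter K a b ∧ p ∈ segment ℝ a b := by
  obtain ⟨hpi, c, hc⟩ := hp
  have hpK := interior_subset hpi
  obtain ⟨q, hq, hmax⟩ := hK.exists_isMaxOn ⟨p, hpK⟩
    (f := fun y => ‖y - p‖) (by fun_prop)
  replace hmax : ∀ y ∈ K, ‖y - p‖ ≤ ‖q - p‖ := hmax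
  obtain ⟨w₀, hw₀⟩ := exists_norm_eq E3 zero_le_one
  have hn : 0 < ‖q - p‖ := by
    obtain ⟨s, t, hs, ht, -, h⟩ := exists_chord_through hK hconv hpi hc hw₀
    have := hmax _ ((h s).2 ⟨by linarith, le_rfl⟩)
    rw [add_sub_cancel_left, norm_smul, hw₀, Real.norm_of_nonneg hs.le] at this
    linarith
  set R := ‖q - p‖ with hR
  set e : E3 := R⁻¹ • (q - p) with he_def
  have he : ‖e‖ = 1 := norm_smul_inv_norm (norm_pos_iff.1 hn)
  have hqe : p + R • e = q := by
    rw [he_def, smul_smul, mul_inv_cancel₀ hn.ne', one_smul, add_sub_cancel]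
  obtain ⟨s, t, hs, ht, hst, h⟩ := exists_chord_through hK hconv hpi hc he
  have hsR : s = R := by
    apply le_antisymm
    · have := hmax _ ((h s).2 ⟨by linarith, le_rfl⟩)
      rwa [add_sub_cancel_left, norm_smul, he, Real.norm_of_nonneg hs.le, mul_one] at this
    · exact ((h R).1 (by rwa [hqe])).2
  obtain ⟨hch, hseg, -⟩ := isChord_of_forall_mem_iff hs ht he h
  refine ⟨_, _, ⟨hch, e, ?_, fun x hx => ⟨?_, ?_⟩⟩, hseg⟩
  · simp only [inner_add_right, inner_smul_right, real_inner_self_eq_norm_sq, he]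
    linarith
  -- No arm exceeds `R`, so by constant chord length none is shorter than `t = c - R`: K contains
  -- the ball of radius `t` about p.
  · have hball : ∀ w : E3, ‖w‖ = 1 → ∀ r : ℝ, 0 ≤ r → r ≤ t → p + r • w ∈ K := by
      intro w hw r h0 hr
      obtain ⟨s', t', hs', ht', hst', h'⟩ := exists_chord_through hK hconv hpi hc hw
      refine (h' r).2 ⟨by linarith, ?_⟩
      have := hmax _ ((h' (-t')).2 ⟨le_rfl, by linarith⟩)
      rw [add_sub_cancel_left, norm_smul, hw, norm_neg, Real.norm_of_nonneg ht'.le, mul_one] at this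
      linarith
    have hnot : p + (-t) • e ∉ interior K := by
      intro hmem
      obtain ⟨s', t', hs', ht', h'⟩ := exists_forall_add_smul_mem_iff hK hconv hmem he
      have h1 := (h' (-t')).2 ⟨le_rfl, by linarith⟩
      rw [add_assoc, ← add_smul, h] at h1
      linarith
    obtain ⟨f, hf⟩ := geometric_hahn_banach_open_point hconv.interior isOpen_interior hnot
    have hfK : ∀ y ∈ K, f y ≤ f (p + (-t) • e) := by
      intro y hy
      have hcl : y ∈ closure (interior K) := by
        rw [hconv.closure_interior_eq_closure_of_nonempty_interior ⟨p, hpi⟩]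
        exact subset_closure hy
      exact closure_minimal (fun y hy => (hf y hy).le)
        (isClosed_le f.continuous continuous_const) hcl
    set v : E3 := (InnerProductSpace.toDual ℝ E3).symm f with hv
    have hfv : ∀ y, f y = inner ℝ v y := fun y => by
      rw [hv, InnerProductSpace.toDual_symm_apply]
    have hlt := hf p hpi
    simp only [hfv, inner_add_right, inner_smul_right] at hfK hlt
    have hv0 : v ≠ 0 := by
      intro h0
      rw [h0, inner_zero_left] at hlt
      simp at hlt
    have hvn : 0 < ‖v‖ := norm_pos_iff.2 hv0
    have h1 := hfK _ (hball _ (norm_smul_inv_norm (𝕜 := ℝ) hv0) t ht.le le_rfl)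
    rw [inner_add_right, inner_smul_right, inner_smul_right, real_inner_self_eq_norm_sq] at h1
    -- A support plane of K at `p - t • e` also supports the inner ball there. This forces equality
    -- in Cauchy–Schwarz, so its normal is a positive multiple of `-e`.
    have h2 : ‖v‖ ≤ inner ℝ v (-e) := by
      have h3 : ((‖v‖⁻¹ : ℝ) : ℝ) * ‖v‖ ^ 2 = ‖v‖ := by field_simp
      simp only [RCLike.ofReal_real_eq_id, id_eq] at h1
      rw [h3] at h1
      rw [inner_neg_right]
      nlinarith
    have h4 : inner ℝ v (-e) = ‖v‖ * ‖-e‖ := by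
      apply le_antisymm (real_inner_le_norm _ _)
      rw [norm_neg, he, mul_one]
      exact h2
    have h5 := inner_eq_norm_mul_iff_real.1 h4
    rw [norm_neg, he, one_smul] at h5
    have h6 := hfK x hx
    rw [h5] at h6
    simp only [inner_smul_left, inner_neg_left, real_inner_self_eq_norm_sq, he] at h6
    simp only [inner_add_right, inner_smul_right, real_inner_self_eq_norm_sq, he]
    simp only [RCLike.conj_to_real] at h6
    nlinarith
  · have h1 := real_inner_le_norm e (x - p)
    have h2 := hmax x hx
    rw [he, one_mul] at h1
    rw [inner_sub_right] at h1
    simp only [inner_add_right, inner_smul_right, real_inner_self_eq_norm_sq, he]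
    linarith

end Existence

/-! ### Invariance under rotations about the affine diameter. -/

theorem IsAffineDiameter.isBodyOfRevolution {K : Set E3} {p a b : E3} (hK : IsCompact K)
    (hconv : Convex ℝ K) (hp : IsEquichordalPoint K p)
    (hproj : ∀ u ∈ Metric.sphere (0 : E3) 1, IsEquichordalPoint (proj u '' K) (proj u p))
    (hab : IsAffineDiameter K a b) (hpab : p ∈ segment ℝ a b) :
    IsBodyOfRevolution K (affineSpan ℝ {a, b}) := by
  have hne : a - b ≠ 0 := sub_ne_zero.2 hab.1.1
  have hpl : p ∈ affineSpan ℝ {a, b} := by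
    rw [segment_eq_image_lineMap] at hpab
    obtain ⟨r, -, rfl⟩ := hpab
    exact AffineMap.lineMap_mem_affineSpan_pair _ _ _
  have key : ∀ g : E3 ≃ᵃⁱ[ℝ] E3, (∀ x ∈ affineSpan ℝ {a, b}, g x = x) → ∀ x ∈ K, g x ∈ K := by
    intro g hg x hx
    have hdist : ∀ y ∈ affineSpan ℝ {a, b}, ‖g x - y‖ = ‖x - y‖ := by
      intro y hy
      conv_lhs => rw [← hg y hy]
      rw [← dist_eq_norm, ← dist_eq_norm, g.dist_map]
    have hpn := hdist p hpl
    have hin : inner ℝ (a - b) (g x - p) = inner ℝ (a - b) (x - p) := by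
      -- The distances to `a` and `b` determine the height along the axis, and `g` preserves both.
      have hpol : ∀ y : E3, ‖y - b‖ ^ 2 - ‖y - a‖ ^ 2 =
          2 * inner ℝ (a - b) (y - p) + (‖p - b‖ ^ 2 - ‖p - a‖ ^ 2) := by
        intro y
        simp only [norm_sub_sq_real, inner_sub_left, inner_sub_right, real_inner_comm]
        ring
      have h1 := hpol (g x)
      rw [hdist a (left_mem_affineSpan_pair ℝ a b), hdist b (right_mem_affineSpan_pair ℝ a b),
        hpol x] at h1
      linarith
    refine mem_of_inner_eq_of_norm_eq (e := ‖a - b‖⁻¹ • (a - b)) hK.isClosed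
      (norm_smul_inv_norm (𝕜 := ℝ) hne) (fun u hu hue y hy => ?_) hx ?_ hpn
    · refine hab.sub_inner_smul_mem hK hconv hp hproj hpab hu ?_ hy
      rw [inner_smul_right] at hue
      exact (mul_eq_zero.1 hue).resolve_left (inv_ne_zero (norm_ne_zero_iff.2 hne))
    · rw [inner_smul_left, inner_smul_left, hin]
  intro f hf
  refine Set.Subset.antisymm (Set.image_subset_iff.2 (key f hf.1)) fun x hx => ?_
  refine ⟨f.symm x, key f.symm (fun y hy => ?_) x hx, f.apply_symm_apply x⟩
  rw [← hf.1 y hy, f.symm_apply_apply, hf.1 y hy]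

end BodyGeom

theorem theorem6p2 (K : Set E3) (hcomp : IsCompact K) (hint : (interior K).Nonempty)
    (hconv : StrictConvex ℝ K) (p : E3) (hp : BodyGeom.IsEquichordalPoint K p)
    (hproj : ∀ u ∈ Metric.sphere (0 : E3) 1,
      BodyGeom.IsEquichordalPoint (BodyGeom.proj u '' K) (BodyGeom.proj u p)) :
    (∃ a b : E3, BodyGeom.IsAffineDiameter K a b ∧ p ∈ segment ℝ a b) ∧
      ∀ a b : E3, BodyGeom.IsAffineDiameter K a b → p ∈ segment ℝ a b →
        BodyGeom.IsBodyOfRevolution K (affineSpan ℝ {a, b}) :=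
  ⟨BodyGeom.exists_isAffineDiameter hcomp hconv.convex hp, fun _ _ hab hpab =>
    hab.isBodyOfRevolution hcomp hconv.convex hp hproj hpab⟩
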